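/- Let $N\ge 0$ and let $m_1,\dots,m_N,n_1,\dots,n_N$ be positive integers. Put \[ A(x)=\prod_{i=1}^N A_i(x),\qquad A_i(x)=1+x^{m_i}+\dots+x^{m_i(n_i-1)}=\frac{x^{m_in_i}-1}{x^{m_i}-1}, \] and let $d_{ij}=\gcd(m_i,m_j)$. Let $\Phi_s$ denote the $s$-th cyclotomic polynomial, and let $S_A$ be the set of prime powers $p^\alpha$ ($p$ prime, $\alpha\ge 1$) such that $\Phi_{p^\alpha}(x)$ divides $A(x)$. Then the following are equivalent: (i) $A(x)$ has coefficients $0,1$, i.e. $A(x)=\sum_{a\in A}x^a$ for a finite set $A\subset\{0,1,2,\dots\}$, and the set $A$ tiles $\mathbf Z$ by translations, i.e. there is a set $B\subset\mathbf Z$ such that every integer can be uniquely represented as $a+b$ with $a\in A$, $b\in B$; (ii) $A(x)$ satisfies both (T1) $A(1)=\prod_{s\in S_A}\Phi_s(1)$, and (T2) if $k\ge 1$ and $s_1,\dots,s_k\in S_A$ are powers of different primes, then $\Phi_{s_1\cdots s_k}(x)$ divides $A(x)$; (iii) the factors $A_1,\dots,A_N$ can be relabelled so that, for each $i=1,\dots,N-1$,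 \[ n_i\ \Big|\ \gcd\Big(\frac{m_{i+1}}{d_{i,i+1}},\dots,\frac{m_N}{d_{i,N}}\Big). \] In particular (equivalence of (i) and (ii)), the Coven--Meyerowitz conjecture holds for all products of this form. -/

import Mathlib

open Polynomial

/-- The polynomial `1 + x^m + x^(2m) + ⋯ + x^(m(n-1)) = (x^(mn) - 1) / (x^m - 1)`. -/
noncomputable def progressionPoly (m n : ℕ) : ℤ[X] :=
  ∑ j ∈ Finset.range n, X ^ (m * j)

/-- The product `∏ i, (x^(mᵢnᵢ) - 1) / (x^(mᵢ) - 1)`. -/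
noncomputable def progressionProd {N : ℕ} (m n : Fin N → ℕ) : ℤ[X] :=
  ∏ i, progressionPoly (m i) (n i)

/-- `A` tiles `ℤ` by translations: there is `B ⊆ ℤ` such that every integer is uniquely
`a + b` with `a ∈ A` and `b ∈ B`. -/
def TilesInt (A : Set ℤ) : Prop :=
  ∃ B : Set ℤ, AddSubgroup.IsComplement A B

/-- Condition (T): `P(x) = ∑_{a ∈ A} x^a` for a finite set `A` of nonnegative integers, and `A`
tiles `ℤ` by translations. -/
def ConditionT (P : ℤ[X]) : Prop :=
  ∃ A : Finset ℕ, P = ∑ a ∈ A, X ^ a ∧ TilesInt ((fun a : ℕ => (a : ℤ)) '' (A : Set ℕ))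

/-- `S_P`: the prime powers `s = p^α` (`α ≥ 1`) such that `Φ_s` divides `P`. -/
def cyclotomicPrimePowers (P : ℤ[X]) : Set ℕ :=
  {s | IsPrimePow s ∧ cyclotomic s ℤ ∣ P}

/-- Condition (T1): `P(1) = ∏_{s ∈ S_P} Φ_s(1)`. (The set `S_P` is finite when `P ≠ 0`.) -/
def ConditionT1 (P : ℤ[X]) : Prop :=
  P.eval 1 = ∏ᶠ s ∈ cyclotomicPrimePowers P, (cyclotomic s ℤ).eval 1

/-- Condition (T2): if `s₁, …, s_k ∈ S_P` (`k ≥ 1`) are powers of different primes, then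
`Φ_{s₁⋯s_k}` divides `P`. Here `F` is the set of primes involved, and `p ^ α p` is the
power of `p` in question. -/
def ConditionT2 (P : ℤ[X]) : Prop :=
  ∀ (F : Finset ℕ) (α : ℕ → ℕ), F.Nonempty → (∀ p ∈ F, p.Prime) →
    (∀ p ∈ F, p ^ α p ∈ cyclotomicPrimePowers P) →
      cyclotomic (∏ p ∈ F, p ^ α p) ℤ ∣ P

/-- The divisibility tower, for the given labelling of the factors:
`nᵢ ∣ gcd (m_{i+1} / d_{i,i+1}, …, m_N / d_{i,N})` for each `i`, where `d_{ij} = gcd (mᵢ, m_j)`.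
For the last index the gcd is over the empty set, hence `0`, and nothing is required. -/
def DivisibilityTower {N : ℕ} (m n : Fin N → ℕ) : Prop :=
  ∀ i : Fin N, n i ∣ (Finset.Ioi i).gcd (fun j => m j / Nat.gcd (m i) (m j))

/-!
A tiling of `ℤ` by a finite set is periodic (Newman), and in a tiling of a finite group a factor of
size `q` may be dilated by any integer prime to `q` (Tijdeman). If `∏ A_i` tiles and
`∑ c_i m_i = 0` with each `c_i` prime to `n_i > 1`, then dilating the `i`-th factor by `|c_i|`
creates two representations of one exponent; so no such relation exists. When no factor can be put
first in a divisibility tower, each factor contains a progression of prime length `p_i` and step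
`t_i` such that some other step `t_j` is no more divisible by `p_i`, strictly less so if
`p_j = p_i`. These pairwise comparisons combine to a forbidden relation among the `t_i`.

In a tower, the prime powers `s` with `Φ_s ∣ A_i` divide all later `m_j`. Hence the sets `S_{A_i}`
are disjoint, which gives (T1), and `Φ_{s₁⋯s_k}` divides the last factor involved, which gives (T2).
From (T1) and (T2) Coven and Meyerowitz construct a complement modulo a common multiple of `S_A`.
-/

/-- The polynomials with nonnegative coefficients: the generating functions of finite multisets
of natural numbers. -/
def nonnegCoeff : Subsemiring ℤ[X] where
  carrier := {P | ∀ a, 0 ≤ P.coeff a}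
  mul_mem' hP hQ a := by
    rw [coeff_mul]
    exact Finset.sum_nonneg fun x _ => mul_nonneg (hP _) (hQ _)
  one_mem' a := by
    rw [coeff_one]
    split_ifs <;> norm_num
  add_mem' hP hQ a := by
    rw [coeff_add]
    exact add_nonneg (hP a) (hQ a)
  zero_mem' _ := (coeff_zero _).ge

theorem X_pow_mem_nonnegCoeff (a : ℕ) : (X ^ a : ℤ[X]) ∈ nonnegCoeff := by
  intro b
  rw [coeff_X_pow]
  split_ifs <;> norm_num

theorem progressionPoly_mem_nonnegCoeff (m n : ℕ) : progressionPoly m n ∈ nonnegCoeff :=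
  sum_mem fun _ _ => X_pow_mem_nonnegCoeff _

theorem progressionProd_mem_nonnegCoeff {N : ℕ} (m n : Fin N → ℕ) :
    progressionProd m n ∈ nonnegCoeff :=
  prod_mem fun _ _ => progressionPoly_mem_nonnegCoeff _ _

theorem expand_mem_nonnegCoeff {k : ℕ} (hk : 0 < k) {P : ℤ[X]} (hP : P ∈ nonnegCoeff) :
    expand ℤ k P ∈ nonnegCoeff := by
  intro a
  rw [coeff_expand hk]
  split_ifs
  exacts [hP _, le_rfl]

theorem progressionPoly_mul (m a b : ℕ) :
    progressionPoly m (a * b) = progressionPoly m a * progressionPoly (m * a) b := by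
  rw [mul_comm a b, progressionPoly, progressionPoly, progressionPoly, Finset.sum_mul_sum,
    Finset.sum_range, ← finProdFinEquiv.sum_comp, Fintype.sum_prod_type, Finset.sum_comm,
    Finset.sum_range]
  refine Finset.sum_congr rfl fun i _ => ?_
  rw [Finset.sum_range]
  refine Finset.sum_congr rfl fun j _ => ?_
  rw [← pow_add, finProdFinEquiv_apply_val]
  ring_nf

theorem expand_progressionPoly (m n k : ℕ) :
    expand ℤ k (progressionPoly m n) = progressionPoly (k * m) n := by
  simp [progressionPoly, ← pow_mul, mul_assoc]

theorem eval_one_progressionPoly (m n : ℕ) : (progressionPoly m n).eval 1 = n := by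
  simp [progressionPoly, eval_finsetSum]

theorem coeff_prod_progressionPoly {ι : Type*} [Fintype ι] [DecidableEq ι] (m n : ι → ℕ) (a : ℕ) :
    (∏ i, progressionPoly (m i) (n i)).coeff a =
      (({f ∈ Fintype.piFinset fun i => Finset.range (n i) | ∑ i, m i * f i = a}).card : ℤ) := by
  simp only [progressionPoly, Finset.prod_univ_sum, Finset.prod_pow_eq_pow_sum, finsetSum_coeff,
    coeff_X_pow, eq_comm (a := a), Finset.sum_boole]

/-- Convolution of a function on `G` with the finitely supported measure `∑ a, P.coeff a • δ_a`,
for `G = ℤ` or `G = ZMod M`. It is encoded as the action of `ℤ[X]` on functions in which `X` is the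
translation by `1`, so that products of polynomials become compositions. -/
noncomputable def convolve (G : Type*) [AddCommGroupWithOne G] :
    ℤ[X] →ₐ[ℤ] Module.End ℤ (G → ℤ) :=
  aeval (LinearMap.funLeft ℤ ℤ fun x : G => x - 1)

section Convolve

variable {G : Type*} [AddCommGroupWithOne G]

theorem convolve_X_pow_apply (a : ℕ) (β : G → ℤ) (x : G) :
    convolve G (X ^ a) β x = β (x - a) := by
  induction a generalizing x with
  | zero => simp
  | succ a ih =>
    have hX : convolve G X (convolve G (X ^ a) β) x = convolve G (X ^ a) β (x - 1) := by
      simp [convolve, LinearMap.funLeft_apply]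
    rw [pow_succ', map_mul, Module.End.mul_apply, hX, ih, sub_sub, Nat.cast_succ, add_comm]

theorem convolve_apply (P : ℤ[X]) (β : G → ℤ) (x : G) :
    convolve G P β x = ∑ a ∈ P.support, P.coeff a * β (x - a) := by
  conv_lhs => rw [P.as_sum_support_C_mul_X_pow]
  simp only [C_mul', map_sum, map_smul, LinearMap.sum_apply, Finset.sum_apply,
    LinearMap.smul_apply, Pi.smul_apply, convolve_X_pow_apply, smul_eq_mul]

theorem convolve_one (P : ℤ[X]) : convolve G P 1 = fun _ => P.eval 1 := by
  funext x
  simp only [convolve_apply, Pi.one_apply, eval_eq_sum, Polynomial.sum, one_pow]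

theorem convolve_nonneg {P : ℤ[X]} (hP : P ∈ nonnegCoeff) {β : G → ℤ} (hβ : 0 ≤ β) :
    0 ≤ convolve G P β := by
  intro x
  rw [convolve_apply]
  exact Finset.sum_nonneg fun a _ => mul_nonneg (hP a) (hβ _)

theorem coeff_mul_le_convolve {P : ℤ[X]} (hP : P ∈ nonnegCoeff) {β : G → ℤ} (hβ : 0 ≤ β)
    (a : ℕ) (x : G) : P.coeff a * β (x - a) ≤ convolve G P β x := by
  have hterm : ∀ a ∈ P.support, 0 ≤ P.coeff a * β (x - a) := fun a _ => mul_nonneg (hP a) (hβ _)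
  rw [convolve_apply]
  by_cases ha : a ∈ P.support
  · exact Finset.single_le_sum hterm ha
  · rw [notMem_support_iff.mp ha, zero_mul]
    exact Finset.sum_nonneg hterm

theorem sum_convolve [Fintype G] (P : ℤ[X]) (β : G → ℤ) :
    ∑ x, convolve G P β x = P.eval 1 * ∑ x, β x := by
  have hshift (a : ℕ) : ∑ x : G, β (x - a) = ∑ x, β x := (Equiv.subRight (a : G)).sum_comp β
  simp only [convolve_apply]
  rw [Finset.sum_comm]
  simp only [← Finset.mul_sum, hshift, ← Finset.sum_mul, eval_eq_sum, Polynomial.sum, one_pow,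
    mul_one]

theorem convolve_comp_intCast (P : ℤ[X]) (β : G → ℤ) :
    convolve ℤ P (fun x => β x) = fun x : ℤ => convolve G P β x := by
  funext x
  simp [convolve_apply]

end Convolve

/-- `P` weakly tiles `G` (`ℤ` or `ZMod M`): some translates of `P`, repeated according to a
nonnegative integer multiplicity `β`, cover every point of `G` exactly once. -/
def WeaklyTiles (G : Type*) [AddCommGroupWithOne G] (P : ℤ[X]) : Prop :=
  ∃ β : G → ℤ, 0 ≤ β ∧ convolve G P β = 1

section WeaklyTiles

variable {G : Type*} [AddCommGroupWithOne G] {P Q R : ℤ[X]}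

theorem WeaklyTiles.of_mul (h : WeaklyTiles G (P * R)) (hR : R ∈ nonnegCoeff) :
    WeaklyTiles G P := by
  obtain ⟨β, hβ, h⟩ := h
  exact ⟨convolve G R β, convolve_nonneg hR hβ, by rwa [map_mul, Module.End.mul_apply] at h⟩

theorem WeaklyTiles.coeff_le_one (h : WeaklyTiles G P) (hP : P ∈ nonnegCoeff) (a : ℕ) :
    P.coeff a ≤ 1 := by
  obtain ⟨β, hβ, h⟩ := h
  obtain ⟨x, hx⟩ : ∃ x, 0 < β x := by
    by_contra! hβ'
    have hβ0 : β = 0 := le_antisymm hβ' hβ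
    simpa [hβ0] using congrFun h 0
  have hle := coeff_mul_le_convolve hP hβ a (x + a)
  rw [h, add_sub_cancel_right, Pi.one_apply] at hle
  nlinarith [hP a]

theorem WeaklyTiles.of_zmod {M : ℕ} (h : WeaklyTiles (ZMod M) P) : WeaklyTiles ℤ P := by
  obtain ⟨β, hβ, h⟩ := h
  exact ⟨fun x => β x, fun x => hβ x, by rw [convolve_comp_intCast, h]; rfl⟩

theorem le_one_of_convolve_eq_one (hP : P ∈ nonnegCoeff) {β : G → ℤ} (hβ : 0 ≤ β)
    (h : convolve G P β = 1) (x : G) : β x ≤ 1 := by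
  obtain ⟨a, ha⟩ : ∃ a, P.coeff a ≠ 0 := by
    by_contra! hP0
    simpa [Polynomial.ext (q := 0) hP0] using congrFun h 0
  have hle := coeff_mul_le_convolve hP hβ a (x + a)
  rw [h, add_sub_cancel_right, Pi.one_apply] at hle
  nlinarith [(hP a).lt_of_ne' ha, hβ x]

theorem tilesInt_image_natCast_iff (A : Finset ℕ) :
    TilesInt ((fun a : ℕ => (a : ℤ)) '' (A : Set ℕ)) ↔
      ∃ B : Set ℤ, ∀ x : ℤ, ∃! a : ℕ, a ∈ A ∧ x - a ∈ B := by
  refine exists_congr fun B => AddSubgroup.isComplement_iff_existsUnique.trans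
    (forall_congr' fun x => ⟨?_, ?_⟩)
  · rintro ⟨⟨⟨_, a, ha, rfl⟩, b⟩, hab, huniq⟩
    have hxb : x - a = b := sub_eq_of_eq_add' hab.symm
    refine ⟨a, ⟨ha, hxb ▸ b.2⟩, fun a' ⟨ha', hb'⟩ => ?_⟩
    have heq := huniq ⟨⟨a', a', ha', rfl⟩, ⟨x - a', hb'⟩⟩ (add_sub_cancel _ _)
    exact Nat.cast_injective (R := ℤ) (congrArg (fun z => (z.1 : ℤ)) heq)
  · rintro ⟨a, ⟨ha, hb⟩, huniq⟩
    refine ⟨⟨⟨a, a, ha, rfl⟩, ⟨x - a, hb⟩⟩, add_sub_cancel _ _, ?_⟩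
    rintro ⟨⟨_, a', ha', rfl⟩, ⟨b, hb'⟩⟩ rfl
    obtain rfl := huniq a' ⟨ha', by simpa using hb'⟩
    simp

theorem convolve_sum_X_pow_indicator (A : Finset ℕ) (B : Set ℤ) :
    convolve ℤ (∑ a ∈ A, X ^ a) (B.indicator 1) = 1 ↔
      ∀ x : ℤ, ∃! a : ℕ, a ∈ A ∧ x - a ∈ B := by
  classical
  refine funext_iff.trans (forall_congr' fun x => ?_)
  simp only [map_sum, LinearMap.sum_apply, Finset.sum_apply, convolve_X_pow_apply,
    Set.indicator_apply, Pi.one_apply, Finset.sum_boole, Nat.cast_eq_one, Finset.card_eq_one,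
    Finset.singleton_iff_unique_mem, Finset.mem_filter]

theorem conditionT_iff : ConditionT P ↔ P ∈ nonnegCoeff ∧ WeaklyTiles ℤ P := by
  simp only [ConditionT, tilesInt_image_natCast_iff, ← convolve_sum_X_pow_indicator]
  constructor
  · rintro ⟨A, rfl, B, hB⟩
    exact ⟨sum_mem fun a _ => X_pow_mem_nonnegCoeff a, B.indicator 1,
      Set.indicator_nonneg fun _ _ => zero_le_one, hB⟩
  · rintro ⟨hP, hT⟩
    have hsum : P = ∑ a ∈ P.support, X ^ a := by
      conv_lhs => rw [P.as_sum_support_C_mul_X_pow]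
      refine Finset.sum_congr rfl fun a ha => ?_
      have hpos : 0 < P.coeff a := (hP a).lt_of_ne' (mem_support_iff.mp ha)
      rw [le_antisymm (hT.coeff_le_one hP a) hpos, C_1, one_mul]
    obtain ⟨β, hβ, h⟩ := hT
    have hβB : β = Set.indicator {x | β x = 1} 1 := by
      classical
      funext x
      rw [Set.indicator_apply]
      split_ifs with hx
      · exact hx
      · exact le_antisymm
          (Int.lt_add_one_iff.mp ((le_one_of_convolve_eq_one hP hβ h x).lt_of_ne hx)) (hβ x)
    refine ⟨P.support, hsum, {x | β x = 1}, ?_⟩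
    rw [← hsum, ← hβB, h]

end WeaklyTiles

section Periodicity

variable {P : ℤ[X]}

theorem apply_sub_eq_zero_of_convolve_eq_zero {δ : ℤ → ℤ} {a : ℕ} (ha : a ∈ P.support) {x : ℤ}
    (h : convolve ℤ P δ x = 0) (hδ : ∀ b ∈ P.support, b ≠ a → δ (x - b) = 0) : δ (x - a) = 0 := by
  rw [convolve_apply, Finset.sum_eq_single_of_mem a ha
    fun b hb hba => by rw [hδ b hb hba, mul_zero]] at h
  exact (mul_eq_zero.mp h).resolve_left (mem_support_iff.mp ha)

theorem eq_zero_of_convolve_eq_zero (hP : P ≠ 0) {δ : ℤ → ℤ} (h : convolve ℤ P δ = 0) (t : ℤ)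
    (ht : ∀ x, t ≤ x → x < t + (P.natDegree - P.natTrailingDegree) → δ x = 0) : δ = 0 := by
  set L : ℤ := P.natDegree - P.natTrailingDegree
  have hup (y : ℤ) (hy : ∀ x, y ≤ x → x < y + L → δ x = 0) : δ (y + L) = 0 := by
    have := apply_sub_eq_zero_of_convolve_eq_zero (x := y + P.natDegree)
      (natTrailingDegree_mem_support_of_nonzero hP) (congrFun h _) fun b hb hne => ?_
    · rwa [add_sub_assoc] at this
    · have := natTrailingDegree_le_of_mem_supp b hb
      have := le_natDegree_of_mem_supp b hb
      exact hy _ (by omega) (by omega)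
  have hdown (y : ℤ) (hy : ∀ x, y ≤ x → x < y + L → δ x = 0) : δ (y - 1) = 0 := by
    have := apply_sub_eq_zero_of_convolve_eq_zero (x := y - 1 + P.natDegree)
      (natDegree_mem_support_of_nonzero hP) (congrFun h _) fun b hb hne => ?_
    · rwa [add_sub_cancel_right] at this
    · have := natTrailingDegree_le_of_mem_supp b hb
      have := le_natDegree_of_mem_supp b hb
      exact hy _ (by omega) (by omega)
  have hwindow (y : ℤ) : ∀ x, y ≤ x → x < y + L → δ x = 0 := by
    induction y using Int.inductionOn' (b := t) with
    | zero => exact ht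
    | succ y _ ih =>
      intro x hx hx'
      obtain rfl | hne := eq_or_ne x (y + L)
      exacts [hup y ih, ih x (by omega) (by omega)]
    | pred y _ ih =>
      intro x hx hx'
      obtain rfl | hne := eq_or_ne x (y - 1)
      exacts [hdown y ih, ih x (by omega) (by omega)]
  funext x
  simpa using hup (x - L) (hwindow _)

/-- The pigeonhole principle of Newman: a tiling is determined by a window as long as the tile, and
there are only finitely many windows. -/
theorem exists_periodic_of_convolve_eq_one (hP : P ∈ nonnegCoeff) {β : ℤ → ℤ} (hβ : 0 ≤ β)
    (h : convolve ℤ P β = 1) : ∃ M : ℕ, M ≠ 0 ∧ Function.Periodic β M := by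
  have hP0 : P ≠ 0 := by
    rintro rfl
    simpa using congrFun h 0
  obtain ⟨s, t, hne, heq⟩ := Finite.exists_ne_map_eq_of_infinite
    fun (t : ℕ) (i : Fin (P.natDegree - P.natTrailingDegree)) =>
      (⟨β (t + i), hβ _, le_one_of_convolve_eq_one hP hβ h _⟩ : Set.Icc (0 : ℤ) 1)
  wlog hlt : s < t generalizing s t
  · exact this t s hne.symm heq.symm (by omega)
  refine ⟨t - s, by omega, ?_⟩
  have hδ : convolve ℤ (1 - X ^ (t - s)) β = 0 := by
    refine eq_zero_of_convolve_eq_zero hP0 ?_ t fun x hx hx' => ?_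
    · rw [← Module.End.mul_apply, ← map_mul, mul_comm, map_mul, Module.End.mul_apply, h,
        convolve_one]
      exact funext fun _ => by simp
    · have hwin := congrArg Subtype.val (congrFun heq ⟨(x - t).toNat, by omega⟩)
      simp only at hwin
      rw [map_sub, map_one, LinearMap.sub_apply, Pi.sub_apply, Module.End.one_apply,
        convolve_X_pow_apply, sub_eq_zero]
      convert hwin.symm using 2 <;> omega
  intro x
  have := congrFun hδ (x + (t - s : ℕ))
  rwa [map_sub, map_one, LinearMap.sub_apply, Pi.sub_apply, Module.End.one_apply,
    convolve_X_pow_apply, add_sub_cancel_right, Pi.zero_apply, sub_eq_zero] at this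

theorem WeaklyTiles.exists_zmod (h : WeaklyTiles ℤ P) (hP : P ∈ nonnegCoeff) :
    ∃ M : ℕ, M ≠ 0 ∧ WeaklyTiles (ZMod M) P := by
  obtain ⟨β, hβ, h⟩ := h
  obtain ⟨M, hM, hper⟩ := exists_periodic_of_convolve_eq_one hP hβ h
  have hlift : (fun x : ℤ => β (x : ZMod M).cast) = β := by
    funext x
    rw [ZMod.coe_intCast, Int.emod_def, mul_comm, ← smul_eq_mul, hper.sub_zsmul_eq]
  refine ⟨M, hM, fun x => β x.cast, fun x => hβ _, funext fun x => ?_⟩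
  obtain ⟨x, rfl⟩ := ZMod.intCast_surjective x
  exact (congrFun (convolve_comp_intCast P fun x : ZMod M => β x.cast) x).symm.trans
    (by rw [hlift, h, Pi.one_apply, Pi.one_apply])

end Periodicity

section Dilation

variable {G : Type*} [AddCommGroupWithOne G] {Q R : ℤ[X]}

theorem C_prime_dvd_expand_sub_pow {p : ℕ} (hp : p.Prime) (Q : ℤ[X]) :
    C (p : ℤ) ∣ expand ℤ p Q - Q ^ p := by
  have := Fact.mk hp
  have hmod : (expand ℤ p Q - Q ^ p).map (Int.castRingHom (ZMod p)) = 0 := by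
    rw [Polynomial.map_sub, Polynomial.map_pow, map_expand, ZMod.expand_card, sub_self]
  rw [C_dvd_iff_dvd_coeff]
  intro a
  rw [← ZMod.intCast_zmod_eq_zero_iff_dvd]
  simpa only [coeff_map, eq_intCast, coeff_zero] using congrArg (fun q => coeff q a) hmod

theorem one_le_convolve_expand_prime {p : ℕ} (hp : p.Prime) (hpQ : ¬ (p : ℤ) ∣ Q.eval 1)
    (hQ : Q ∈ nonnegCoeff) {γ : G → ℤ} (hγ : 0 ≤ γ) (h : convolve G Q γ = 1) (x : G) :
    1 ≤ convolve G (expand ℤ p Q) γ x := by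
  obtain ⟨W, hW⟩ := C_prime_dvd_expand_sub_pow hp Q
  have hvalue : convolve G (expand ℤ p Q) γ x =
      Q.eval 1 ^ (p - 1) + p * convolve G W γ x := by
    rw [sub_eq_iff_eq_add'.mp hW, C_mul', ← pow_sub_one_mul hp.ne_zero Q, map_add, map_smul,
      LinearMap.add_apply, Pi.add_apply, LinearMap.smul_apply, Pi.smul_apply, smul_eq_mul, map_mul,
      Module.End.mul_apply, h, convolve_one, eval_pow]
  have hne : convolve G (expand ℤ p Q) γ x ≠ 0 := by
    intro hzero
    rw [hvalue] at hzero
    exact hpQ ((Nat.prime_iff_prime_int.mp hp).dvd_of_dvd_pow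
      ((dvd_add_left (dvd_mul_right _ _)).mp (hzero ▸ dvd_zero (p : ℤ))))
  exact (convolve_nonneg (expand_mem_nonnegCoeff hp.pos hQ) hγ x).lt_of_ne' hne

variable [Finite G]

theorem WeaklyTiles.dilate_prime (h : WeaklyTiles G (Q * R)) (hQ : Q ∈ nonnegCoeff)
    (hR : R ∈ nonnegCoeff) {p : ℕ} (hp : p.Prime) (hpQ : ¬ (p : ℤ) ∣ Q.eval 1) :
    WeaklyTiles G (expand ℤ p Q * R) := by
  cases nonempty_fintype G
  obtain ⟨β, hβ, h⟩ := h
  refine ⟨β, hβ, ?_⟩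
  rw [map_mul, Module.End.mul_apply] at h ⊢
  have hge := one_le_convolve_expand_prime hp hpQ hQ (convolve_nonneg hR hβ) h
  have hsum : ∑ _x : G, (1 : ℤ) = ∑ x, convolve G (expand ℤ p Q) (convolve G R β) x := by
    rw [sum_convolve, expand_eval, one_pow, ← sum_convolve, h]
    rfl
  have heq := (Finset.sum_eq_sum_iff_of_le fun x _ => hge x).mp hsum
  exact funext fun x => (heq x (Finset.mem_univ x)).symm

/-- Tijdeman's theorem. -/
theorem WeaklyTiles.dilate (h : WeaklyTiles G (Q * R)) (hQ : Q ∈ nonnegCoeff)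
    (hR : R ∈ nonnegCoeff) {k : ℕ} (hk : k ≠ 0) (hkQ : IsCoprime (k : ℤ) (Q.eval 1)) :
    WeaklyTiles G (expand ℤ k Q * R) := by
  induction k using Nat.recOnMul generalizing Q with
  | zero => exact absurd rfl hk
  | one => rwa [expand_one]
  | prime p hp =>
    refine h.dilate_prime hQ hR hp fun hdvd => ?_
    exact (Nat.prime_iff_prime_int.mp hp).not_isUnit (hkQ.isUnit_of_dvd' dvd_rfl hdvd)
  | mul a b iha ihb =>
    have hb := right_ne_zero_of_mul hk
    rw [Nat.cast_mul, IsCoprime.mul_left_iff] at hkQ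
    rw [expand_mul]
    refine iha (ihb h hQ hb hkQ.2) (expand_mem_nonnegCoeff hb.bot_lt hQ) (left_ne_zero_of_mul hk) ?_
    rw [expand_eval, one_pow]
    exact hkQ.1

theorem WeaklyTiles.dilate_prod {ι : Type*} (S : Finset ι) {Q : ι → ℤ[X]} {k : ι → ℕ}
    (h : WeaklyTiles G ((∏ i ∈ S, Q i) * R)) (hQ : ∀ i ∈ S, Q i ∈ nonnegCoeff)
    (hR : R ∈ nonnegCoeff) (hk : ∀ i ∈ S, k i ≠ 0)
    (hkQ : ∀ i ∈ S, IsCoprime (k i : ℤ) ((Q i).eval 1)) :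
    WeaklyTiles G ((∏ i ∈ S, expand ℤ (k i) (Q i)) * R) := by
  classical
  induction S using Finset.induction_on generalizing R with
  | empty => simpa using h
  | insert i S hi ih =>
    rw [Finset.forall_mem_insert] at hQ hk hkQ
    rw [Finset.prod_insert hi, mul_assoc] at h ⊢
    rw [mul_left_comm]
    refine ih ?_ hQ.2 (mul_mem (expand_mem_nonnegCoeff hk.1.bot_lt hQ.1) hR) hk.2 hkQ.2
    rw [mul_left_comm]
    exact h.dilate hQ.1 (mul_mem (prod_mem hQ.2) hR) hk.1 hkQ.1

end Dilation

section Relation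

variable {ι : Type*} [Fintype ι] {m n : ι → ℕ}

theorem eq_of_sum_mul_eq_of_coeff_le_one
    (h : ∀ a, (∏ i, progressionPoly (m i) (n i)).coeff a ≤ 1) {f g : ι → ℕ} (hf : ∀ i, f i < n i)
    (hg : ∀ i, g i < n i) (hfg : ∑ i, m i * f i = ∑ i, m i * g i) : f = g := by
  classical
  have hcard := h (∑ i, m i * g i)
  rw [coeff_prod_progressionPoly, Nat.cast_le_one, Finset.card_le_one_iff] at hcard
  exact hcard (by simpa [hf]) (by simp [hg])

/-- Dilating the `i`-th factor by `|c i|` turns the relation `∑ c i * m i = 0` into two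
representations of the same exponent. -/
theorem WeaklyTiles.sum_mul_ne_zero [Nonempty ι] {G : Type*} [AddCommGroupWithOne G] [Finite G]
    {R : ℤ[X]} (h : WeaklyTiles G ((∏ i, progressionPoly (m i) (n i)) * R)) (hR : R ∈ nonnegCoeff)
    (hn : ∀ i, 1 < n i) {c : ι → ℤ} (hc : ∀ i, IsCoprime (c i) (n i)) :
    ∑ i, c i * m i ≠ 0 := by
  intro hsum
  have hc0 (i : ι) : c i ≠ 0 := by
    intro h0
    have hunit := isCoprime_zero_left.mp (h0 ▸ hc i)
    rw [Int.ofNat_isUnit, Nat.isUnit_iff] at hunit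
    exact (hn i).ne' hunit
  have hdilate : WeaklyTiles G (∏ i, progressionPoly ((c i).natAbs * m i) (n i)) := by
    simp only [← expand_progressionPoly]
    refine (h.dilate_prod _ (k := fun i => (c i).natAbs)
      (fun i _ => progressionPoly_mem_nonnegCoeff _ _) hR
      (fun i _ => Int.natAbs_ne_zero.mpr (hc0 i)) fun i _ => ?_).of_mul hR
    rw [eval_one_progressionPoly, Int.natCast_natAbs]
    exact (hc i).abs_left
  have heq := eq_of_sum_mul_eq_of_coeff_le_one
    (hdilate.coeff_le_one (prod_mem fun i _ => progressionPoly_mem_nonnegCoeff _ _))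
    (f := fun i => if 0 < c i then 1 else 0) (g := fun i => if 0 < c i then 0 else 1)
    (fun i => by split_ifs <;> linarith [hn i]) (fun i => by split_ifs <;> linarith [hn i]) ?_
  · obtain ⟨i⟩ := ‹Nonempty ι›
    have := congrFun heq i
    by_cases hi : 0 < c i <;> simp [hi] at this
  · zify
    rw [← sub_eq_zero, ← Finset.sum_sub_distrib]
    refine (Finset.sum_congr rfl fun i _ => ?_).trans hsum
    by_cases hi : 0 < c i
    · simp [hi, abs_of_pos hi]
    · simp [hi, abs_of_nonpos (not_lt.mp hi)]

end Relation

section Cyclotomic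

theorem progressionPoly_mul_X_pow_sub_one (m n : ℕ) :
    progressionPoly m n * (X ^ m - 1) = X ^ (m * n) - 1 := by
  simp only [progressionPoly, pow_mul, geom_sum_mul]

variable {m n : ℕ}

theorem progressionPoly_eq_prod_cyclotomic (hm : 0 < m) (hn : 0 < n) :
    progressionPoly m n = ∏ d ∈ (m * n).divisors \ m.divisors, cyclotomic d ℤ := by
  have hmn := Nat.mul_pos hm hn
  have h := progressionPoly_mul_X_pow_sub_one m n
  rw [← prod_cyclotomic_eq_X_pow_sub_one hmn,
    ← Finset.prod_sdiff (Nat.divisors_subset_of_dvd hmn.ne' (dvd_mul_right m n)),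
    prod_cyclotomic_eq_X_pow_sub_one hm] at h
  exact mul_right_cancel₀ (monic_X_pow_sub_C (1 : ℤ) hm.ne').ne_zero h

theorem progressionPoly_ne_zero (hn : 0 < n) : progressionPoly m n ≠ 0 := by
  intro h
  have heval := eval_one_progressionPoly m n
  rw [h, eval_zero] at heval
  exact hn.ne (Nat.cast_injective (R := ℤ) heval)

theorem eq_of_cyclotomic_dvd_cyclotomic {d e : ℕ} (hd : 0 < d) (he : 0 < e)
    (h : cyclotomic d ℤ ∣ cyclotomic e ℤ) : d = e :=
  cyclotomic_injective (eq_of_monic_of_associated (cyclotomic.monic d ℤ) (cyclotomic.monic e ℤ)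
    ((cyclotomic.irreducible hd).associated_of_dvd (cyclotomic.irreducible he) h))

theorem cyclotomic_dvd_progressionPoly_iff (hm : 0 < m) (hn : 0 < n) {s : ℕ} (hs : 0 < s) :
    cyclotomic s ℤ ∣ progressionPoly m n ↔ s ∣ m * n ∧ ¬ s ∣ m := by
  have hmem : s ∈ (m * n).divisors \ m.divisors ↔ s ∣ m * n ∧ ¬ s ∣ m := by
    simp [hm.ne', hn.ne']
  rw [progressionPoly_eq_prod_cyclotomic hm hn, ← hmem]
  refine ⟨fun h => ?_, Finset.dvd_prod_of_mem _⟩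
  obtain ⟨d, hd, hsd⟩ := ((cyclotomic.irreducible hs).prime.dvd_finsetProd_iff _).mp h
  rwa [eq_of_cyclotomic_dvd_cyclotomic hs
    (Nat.pos_of_mem_divisors (Finset.mem_sdiff.mp hd).1) hsd]

theorem progressionPoly_dvd (hm : 0 < m) (hn : 0 < n) {Q : ℤ[X]}
    (h : ∀ d, d ∣ m * n → ¬ d ∣ m → cyclotomic d ℤ ∣ Q) : progressionPoly m n ∣ Q := by
  rw [progressionPoly_eq_prod_cyclotomic hm hn]
  have hdvd {d : ℕ} (hd : d ∈ (m * n).divisors \ m.divisors) : d ∣ m * n ∧ ¬ d ∣ m := by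
    simpa [hm.ne', hn.ne'] using hd
  refine Finset.prod_dvd_of_isRelPrime (fun d hd e he hne => ?_)
    fun d hd => h d (hdvd hd).1 (hdvd hd).2
  have hmn := Nat.mul_pos hm hn
  have hd0 := Nat.pos_of_dvd_of_pos (hdvd hd).1 hmn
  exact (cyclotomic.irreducible hd0).isRelPrime_iff_not_dvd.mpr fun hde =>
    hne (eq_of_cyclotomic_dvd_cyclotomic hd0 (Nat.pos_of_dvd_of_pos (hdvd he).1 hmn) hde)

theorem mem_cyclotomicPrimePowers_progressionPoly (hm : 0 < m) (hn : 0 < n) {s : ℕ} :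
    s ∈ cyclotomicPrimePowers (progressionPoly m n) ↔ IsPrimePow s ∧ s ∣ m * n ∧ ¬ s ∣ m :=
  and_congr_right fun hs => cyclotomic_dvd_progressionPoly_iff hm hn hs.pos

theorem cyclotomicPrimePowers_prod {ι : Type*} [Fintype ι] (P : ι → ℤ[X]) :
    cyclotomicPrimePowers (∏ i, P i) = ⋃ i, cyclotomicPrimePowers (P i) := by
  ext s
  simp only [cyclotomicPrimePowers, Set.mem_ofPred_eq, Set.mem_iUnion, exists_and_left]
  refine and_congr_right fun hs => ?_
  simp [(cyclotomic.irreducible hs.pos).prime.dvd_finsetProd_iff]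

theorem finite_cyclotomicPrimePowers {P : ℤ[X]} (hP : P ≠ 0) :
    (cyclotomicPrimePowers P).Finite := by
  have hfin : {Q : ℤ[X] | Q.Monic ∧ Q ∣ P}.Finite :=
    Set.finite_coe_iff.mp (@Finite.of_fintype _ (fintypeSubtypeMonicDvd P hP))
  refine Set.Finite.of_injOn (f := fun s => cyclotomic s ℤ) (fun s hs => ?_)
    cyclotomic_injective.injOn hfin
  exact ⟨cyclotomic.monic s ℤ, hs.2⟩

theorem eval_one_cyclotomic_of_not_isPrimePow {d : ℕ} (hd1 : d ≠ 1) (hd : ¬ IsPrimePow d) :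
    (cyclotomic d ℤ).eval 1 = 1 := by
  refine eval_one_cyclotomic_not_prime_pow fun {p} hp k hk => ?_
  obtain rfl | hk0 := eq_or_ne k 0
  exacts [hd1 hk.symm, hd (hk ▸ hp.isPrimePow.pow hk0)]

theorem conditionT1_progressionPoly (hm : 0 < m) (hn : 0 < n) :
    ConditionT1 (progressionPoly m n) := by
  classical
  have hset : cyclotomicPrimePowers (progressionPoly m n) =
      (((m * n).divisors \ m.divisors).filter IsPrimePow : Finset ℕ) := by
    ext s
    rw [mem_cyclotomicPrimePowers_progressionPoly hm hn]
    simp [hm.ne', hn.ne', and_comm]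
  rw [ConditionT1, hset, finprod_mem_coe_finset, progressionPoly_eq_prod_cyclotomic hm hn,
    eval_prod, Finset.prod_filter]
  refine Finset.prod_congr rfl fun d hd => ?_
  split_ifs with hdp
  · rfl
  · refine eval_one_cyclotomic_of_not_isPrimePow ?_ hdp
    rintro rfl
    simp [hm.ne'] at hd

theorem ConditionT1.prod {ι : Type*} [Fintype ι] {P : ι → ℤ[X]} (hP : ∀ i, P i ≠ 0)
    (h : ∀ i, ConditionT1 (P i))
    (hdisj : Pairwise fun i j =>
      Disjoint (cyclotomicPrimePowers (P i)) (cyclotomicPrimePowers (P j))) :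
    ConditionT1 (∏ i, P i) := by
  rw [ConditionT1, cyclotomicPrimePowers_prod, eval_prod,
    finprod_mem_iUnion hdisj fun i => finite_cyclotomicPrimePowers (hP i),
    finprod_eq_prod_of_fintype]
  exact Finset.prod_congr rfl fun i _ => h i

theorem ConditionT1.ne_zero {P : ℤ[X]} (h : ConditionT1 P) : P ≠ 0 := by
  rintro rfl
  rw [ConditionT1, eval_zero] at h
  refine finprod_mem_induction (fun x : ℤ => x ≠ 0) one_ne_zero (fun _ _ => mul_ne_zero)
    (fun s hs => ?_) h.symm
  obtain ⟨p, k, hp, hk, rfl⟩ := (isPrimePow_nat_iff s).mp hs.1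
  have := Fact.mk hp
  obtain ⟨k, rfl⟩ := Nat.exists_eq_add_one.mpr hk
  rw [eval_one_cyclotomic_prime_pow]
  exact_mod_cast hp.ne_zero

end Cyclotomic

section CovenMeyerowitz

variable {P Q : ℤ[X]} {M : ℕ}

theorem weaklyTiles_zmod_of_progressionPoly_dvd (hM : M ≠ 0) (hdvd : progressionPoly 1 M ∣ Q)
    (hQ : Q.eval 1 = M) : WeaklyTiles (ZMod M) Q := by
  have := NeZero.mk hM
  obtain ⟨S, rfl⟩ := hdvd
  have hS : S.eval 1 = 1 := by
    rw [eval_mul, eval_one_progressionPoly] at hQ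
    exact (mul_eq_left₀ (Nat.cast_ne_zero.mpr hM)).mp hQ
  have hcover : convolve (ZMod M) (progressionPoly 1 M) (Pi.single 0 1) = 1 := by
    funext x
    simp only [progressionPoly, one_mul, map_sum, LinearMap.sum_apply, Finset.sum_apply,
      convolve_X_pow_apply]
    rw [Finset.sum_eq_single_of_mem x.val (Finset.mem_range.mpr x.val_lt) fun j hj hne => ?_]
    · simp
    · refine Pi.single_eq_of_ne (fun h => hne ?_) _
      rw [sub_eq_zero.mp h, ZMod.val_natCast_of_lt (Finset.mem_range.mp hj)]
  refine ⟨Pi.single 0 1, Pi.single_nonneg.mpr zero_le_one, ?_⟩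
  rw [mul_comm, map_mul, Module.End.mul_apply, hcover, convolve_one, hS]
  rfl

theorem exists_cyclotomic_mul_dvd (hM : M ≠ 0) {s : ℕ} (hs : IsPrimePow s) :
    ∃ Q ∈ nonnegCoeff, Q.eval 1 = (cyclotomic s ℤ).eval 1 ∧
      ∀ e, s.Coprime e → s * e ∣ M → cyclotomic (s * e) ℤ ∣ Q := by
  obtain ⟨p, k, hp, hk, rfl⟩ := (isPrimePow_nat_iff s).mp hs
  have := Fact.mk hp
  obtain ⟨k, rfl⟩ := Nat.exists_eq_add_one.mpr hk
  -- This is `Φ_s(x ^ L)`, where `L` is the largest divisor of `M` prime to `s`.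
  refine ⟨progressionPoly (ordCompl[p] M * p ^ k) p, progressionPoly_mem_nonnegCoeff _ _, ?_,
    fun e he hse => ?_⟩
  · rw [eval_one_progressionPoly, eval_one_cyclotomic_prime_pow]
  have hpe : Nat.Coprime p e := he.coprime_dvd_left (dvd_pow_self p hk.ne')
  have he0 : 0 < e := Nat.pos_of_dvd_of_pos (dvd_of_mul_left_dvd hse) (Nat.pos_of_ne_zero hM)
  have heL : e ∣ ordCompl[p] M := by
    have heM : e ∣ ordProj[p] M * ordCompl[p] M := by
      rw [Nat.ordProj_mul_ordCompl_eq_self]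
      exact dvd_of_mul_left_dvd hse
    exact (hpe.symm.pow_right _).dvd_of_dvd_mul_left heM
  rw [cyclotomic_dvd_progressionPoly_iff (Nat.mul_pos (Nat.ordCompl_pos p hM) (pow_pos hp.pos k))
    hp.pos (Nat.mul_pos (pow_pos hp.pos _) he0)]
  refine ⟨?_, fun hdvd => ?_⟩
  · rw [mul_assoc, ← pow_succ, mul_comm]
    exact mul_dvd_mul_right heL _
  · refine Nat.not_dvd_ordCompl hp hM (Nat.dvd_of_mul_dvd_mul_right (pow_pos hp.pos k) ?_)
    rw [← pow_succ']
    exact dvd_of_mul_right_dvd hdvd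

theorem ConditionT2.cyclotomic_dvd_mul (h : ConditionT2 P) {d : ℕ} (hd : 1 < d)
    (hQ : ∀ s e, IsPrimePow s → s ∉ cyclotomicPrimePowers P → s.Coprime e → s * e = d →
      cyclotomic d ℤ ∣ Q) : cyclotomic d ℤ ∣ P * Q := by
  have hd0 : d ≠ 0 := by omega
  by_cases hall : ∀ p ∈ d.primeFactors, ordProj[p] d ∈ cyclotomicPrimePowers P
  · have hT2 := h d.primeFactors d.factorization (Nat.nonempty_primeFactors.mpr hd)
      (fun p hp => Nat.prime_of_mem_primeFactors hp) hall
    rw [← Nat.prod_factorization_eq_prod_primeFactors (f := fun p k => p ^ k),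
      Nat.prod_factorization_pow_eq_self hd0] at hT2
    exact hT2.mul_right _
  · push Not at hall
    obtain ⟨p, hp, hps⟩ := hall
    have hpp := Nat.prime_of_mem_primeFactors hp
    refine (hQ (ordProj[p] d) (ordCompl[p] d) ?_ hps ?_
      (Nat.ordProj_mul_ordCompl_eq_self d p)).mul_left _
    · exact hpp.isPrimePow.pow (Finsupp.mem_support_iff.mp hp)
    · exact (Nat.coprime_ordCompl hpp hd0).pow_left _

/-- The complement constructed by Coven and Meyerowitz. -/
theorem exists_complement_of_conditionT1_of_conditionT2 (h1 : ConditionT1 P) (h2 : ConditionT2 P)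
    (hM : M ≠ 0) (hPM : ∀ s ∈ cyclotomicPrimePowers P, s ∣ M) :
    ∃ B ∈ nonnegCoeff, progressionPoly 1 M ∣ P * B ∧ (P * B).eval 1 = M := by
  classical
  have hfin := finite_cyclotomicPrimePowers h1.ne_zero
  have hMpos := Nat.pos_of_ne_zero hM
  have hfinM := finite_cyclotomicPrimePowers (progressionPoly_ne_zero (m := 1) hMpos)
  have hmemM {s : ℕ} (hs : IsPrimePow s) (hsM : s ∣ M) : s ∈ hfinM.toFinset := by
    rw [hfinM.mem_toFinset, mem_cyclotomicPrimePowers_progressionPoly one_pos hMpos, one_mul,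
      Nat.dvd_one]
    exact ⟨hs, hsM, hs.ne_one⟩
  have hsub : hfin.toFinset ⊆ hfinM.toFinset := fun s hs =>
    have hsP := hfin.mem_toFinset.mp hs
    hmemM hsP.1 (hPM s hsP)
  choose! Q hQnonneg hQeval hQdvd using fun s (hs : IsPrimePow s) => exists_cyclotomic_mul_dvd hM hs
  have hisPrimePow {s : ℕ} (hs : s ∈ hfinM.toFinset \ hfin.toFinset) : IsPrimePow s :=
    (hfinM.mem_toFinset.mp (Finset.mem_sdiff.mp hs).1).1
  refine ⟨∏ s ∈ hfinM.toFinset \ hfin.toFinset, Q s,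
    prod_mem fun s hs => hQnonneg s (hisPrimePow hs), ?_, ?_⟩
  · refine progressionPoly_dvd one_pos hMpos fun d hd hd1 =>
      h2.cyclotomic_dvd_mul ?_ fun s e hs hsP hse hd' => ?_
    · rw [one_mul] at hd
      have := Nat.pos_of_dvd_of_pos hd hMpos
      rw [Nat.dvd_one] at hd1
      omega
    · subst hd'
      rw [one_mul] at hd
      refine (hQdvd s hs e hse hd).trans (Finset.dvd_prod_of_mem _ (Finset.mem_sdiff.mpr ⟨?_, ?_⟩))
      · exact hmemM hs (dvd_of_mul_right_dvd hd)
      · rwa [hfin.mem_toFinset]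
  · have hT1M := conditionT1_progressionPoly one_pos hMpos
    rw [ConditionT1, finprod_mem_eq_finite_toFinset_prod _ hfin] at h1
    rw [ConditionT1, finprod_mem_eq_finite_toFinset_prod _ hfinM, eval_one_progressionPoly] at hT1M
    rw [eval_mul, eval_prod, h1, hT1M, mul_comm, ← Finset.prod_sdiff hsub]
    exact congrArg (· * _) (Finset.prod_congr rfl fun s hs => hQeval s (hisPrimePow hs))

theorem weaklyTiles_of_conditionT1_of_conditionT2 (h1 : ConditionT1 P) (h2 : ConditionT2 P) :
    WeaklyTiles ℤ P := by
  have hfin := finite_cyclotomicPrimePowers h1.ne_zero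
  have hM : ∏ s ∈ hfin.toFinset, s ≠ 0 :=
    Finset.prod_ne_zero_iff.mpr fun s hs => (hfin.mem_toFinset.mp hs).1.ne_zero
  obtain ⟨B, hB, hdvd, heval⟩ := exists_complement_of_conditionT1_of_conditionT2 h1 h2 hM
    fun s hs => Finset.dvd_prod_of_mem _ (hfin.mem_toFinset.mpr hs)
  exact ((weaklyTiles_zmod_of_progressionPoly_dvd hM hdvd heval).of_mul hB).of_zmod

end CovenMeyerowitz

section Tower

theorem isPrimePow_dvd_lcm_iff {s a b : ℕ} (hs : IsPrimePow s) (ha : a ≠ 0) (hb : b ≠ 0) :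
    s ∣ a.lcm b ↔ s ∣ a ∨ s ∣ b := by
  obtain ⟨p, k, hp, -, rfl⟩ := (isPrimePow_nat_iff s).mp hs
  simp only [hp.pow_dvd_iff_le_factorization ha, hp.pow_dvd_iff_le_factorization hb,
    hp.pow_dvd_iff_le_factorization (Nat.lcm_ne_zero ha hb), Nat.factorization_lcm ha hb,
    Finsupp.sup_apply, le_sup_iff]

theorem dvd_div_gcd_iff_forall_mem_cyclotomicPrimePowers {m n m' : ℕ} (hm : 0 < m) (hn : 0 < n)
    (hm' : 0 < m') :
    n ∣ m' / m.gcd m' ↔ ∀ s ∈ cyclotomicPrimePowers (progressionPoly m n), s ∣ m' := by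
  have hlcm : n ∣ m' / m.gcd m' ↔ m * n ∣ m.lcm m' := by
    rw [Nat.lcm, Nat.mul_div_assoc m (Nat.gcd_dvd_right m m'), Nat.mul_dvd_mul_iff_left hm]
  rw [hlcm, Nat.dvd_iff_prime_pow_dvd_dvd]
  constructor
  · intro h s hs
    obtain ⟨hs, hsmn, hsm⟩ := (mem_cyclotomicPrimePowers_progressionPoly hm hn).mp hs
    obtain ⟨p, k, hp, -, rfl⟩ := (isPrimePow_nat_iff s).mp hs
    exact ((isPrimePow_dvd_lcm_iff hs hm.ne' hm'.ne').mp (h p k hp hsmn)).resolve_left hsm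
  · intro h p k hp hdvd
    obtain rfl | hk := eq_or_ne k 0
    · exact one_dvd _
    have hpk := hp.isPrimePow.pow hk
    rw [isPrimePow_dvd_lcm_iff hpk hm.ne' hm'.ne', or_iff_not_imp_left]
    exact fun hnot => h _ ((mem_cyclotomicPrimePowers_progressionPoly hm hn).mpr ⟨hpk, hdvd, hnot⟩)

variable {N : ℕ} {m n : Fin N → ℕ}

theorem divisibilityTower_iff :
    DivisibilityTower m n ↔ ∀ i j, i < j → n i ∣ m j / (m i).gcd (m j) := by
  simp only [DivisibilityTower, Finset.dvd_gcd_iff, Finset.mem_Ioi]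

theorem progressionProd_comp_perm (m n : Fin N → ℕ) (σ : Equiv.Perm (Fin N)) :
    progressionProd (m ∘ σ) (n ∘ σ) = progressionProd m n :=
  Equiv.prod_comp σ fun i => progressionPoly (m i) (n i)

theorem DivisibilityTower.dvd_of_lt (h : DivisibilityTower m n) (hm : ∀ i, 0 < m i)
    (hn : ∀ i, 0 < n i) {i j : Fin N} (hij : i < j) {s : ℕ}
    (hs : s ∈ cyclotomicPrimePowers (progressionPoly (m i) (n i))) : s ∣ m j :=
  (dvd_div_gcd_iff_forall_mem_cyclotomicPrimePowers (hm i) (hn i) (hm j)).mp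
    (divisibilityTower_iff.mp h i j hij) s hs

theorem DivisibilityTower.conditionT1 (h : DivisibilityTower m n) (hm : ∀ i, 0 < m i)
    (hn : ∀ i, 0 < n i) : ConditionT1 (progressionProd m n) := by
  have hlt {i j : Fin N} (hij : i < j) :
      Disjoint (cyclotomicPrimePowers (progressionPoly (m i) (n i)))
        (cyclotomicPrimePowers (progressionPoly (m j) (n j))) :=
    Set.disjoint_left.mpr fun s hsi hsj =>
      ((mem_cyclotomicPrimePowers_progressionPoly (hm j) (hn j)).mp hsj).2.2
        (h.dvd_of_lt hm hn hij hsi)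
  exact ConditionT1.prod (fun i => progressionPoly_ne_zero (hn i))
    (fun i => conditionT1_progressionPoly (hm i) (hn i))
    fun i j hij => (lt_or_gt_of_ne hij).elim hlt fun hji => (hlt hji).symm

/-- The last factor divisible by one of the `Φ_{s_i}` is divisible by `Φ_{s₁⋯s_k}`. -/
theorem DivisibilityTower.conditionT2 (h : DivisibilityTower m n) (hm : ∀ i, 0 < m i)
    (hn : ∀ i, 0 < n i) : ConditionT2 (progressionProd m n) := by
  intro F α hF hprime hmem
  have hfactor (p : F) :
      ∃ i, (p : ℕ) ^ α p ∈ cyclotomicPrimePowers (progressionPoly (m i) (n i)) := by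
    have hp := hmem p p.2
    rwa [progressionProd, cyclotomicPrimePowers_prod, Set.mem_iUnion] at hp
  choose f hf using hfactor
  have hlayer (p : F) := (mem_cyclotomicPrimePowers_progressionPoly (hm _) (hn _)).mp (hf p)
  have := hF.to_subtype
  obtain ⟨q, hq⟩ := Finite.exists_max f
  have hpos : 0 < ∏ p ∈ F, p ^ α p := Finset.prod_pos fun p hp => pow_pos (hprime p hp).pos _
  refine dvd_trans ?_ (Finset.dvd_prod_of_mem _ (Finset.mem_univ (f q)))
  refine (cyclotomic_dvd_progressionPoly_iff (hm _) (hn _) hpos).mpr ⟨?_, fun hdvd => ?_⟩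
  · refine Finset.prod_dvd_of_isRelPrime (fun p hp p' hp' hne => ?_) fun p hp => ?_
    · exact Nat.coprime_iff_isRelPrime.mp
        (Nat.coprime_pow_primes _ _ (hprime p hp) (hprime p' hp') hne)
    · obtain hlt | heq := (hq ⟨p, hp⟩).lt_or_eq
      · exact (h.dvd_of_lt hm hn hlt (hf ⟨p, hp⟩)).mul_right _
      · exact heq ▸ (hlayer ⟨p, hp⟩).2.1
  · exact (hlayer q).2.2 ((Finset.dvd_prod_of_mem (fun p => p ^ α p) q.2).trans hdvd)

end Tower

section FirstFactor

theorem exists_progressionPoly_factor {m n p k : ℕ} (hm : 0 < m) (hn : 0 < n) (hp : p.Prime)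
    (h : p ^ k ∈ cyclotomicPrimePowers (progressionPoly m n)) :
    ∃ t, 0 < t ∧ t.factorization p + 1 = k ∧ t * p ∣ m * n ∧
      ∃ R ∈ nonnegCoeff, progressionPoly m n = progressionPoly t p * R := by
  obtain ⟨-, hmn, hnot⟩ := (mem_cyclotomicPrimePowers_progressionPoly hm hn).mp h
  rw [hp.pow_dvd_iff_le_factorization (Nat.mul_pos hm hn).ne',
    Nat.factorization_mul hm.ne' hn.ne', Finsupp.add_apply] at hmn
  rw [hp.pow_dvd_iff_le_factorization hm.ne'] at hnot
  obtain ⟨u, rfl⟩ : ∃ u, k = m.factorization p + u + 1 :=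
    ⟨k - m.factorization p - 1, by omega⟩
  obtain ⟨b, rfl⟩ : p ^ (u + 1) ∣ n := by
    rw [hp.pow_dvd_iff_le_factorization hn.ne']
    omega
  have hpu : 0 < p ^ u := pow_pos hp.pos u
  refine ⟨m * p ^ u, Nat.mul_pos hm hpu, ?_, ⟨b, by ring⟩,
    progressionPoly m (p ^ u) * progressionPoly (m * p ^ u * p) b,
    mul_mem (progressionPoly_mem_nonnegCoeff _ _) (progressionPoly_mem_nonnegCoeff _ _), ?_⟩
  · rw [Nat.factorization_mul hm.ne' hpu.ne', Finsupp.add_apply, hp.factorization_pow,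
      Finsupp.single_eq_same]
  · rw [pow_succ, mul_assoc, progressionPoly_mul, progressionPoly_mul (m * p ^ u), mul_left_comm]

theorem exists_mul_eq_mul_of_factorization_le {t t' p : ℕ} (hp : p.Prime) (ht : 0 < t)
    (ht' : 0 < t') (h : t'.factorization p ≤ t.factorization p) :
    ∃ a b, a * t = b * t' ∧ ¬ p ∣ a ∧ (p ∣ b ↔ t'.factorization p < t.factorization p) := by
  obtain ⟨a, ha⟩ := Nat.ordProj_dvd t' p
  obtain ⟨b, hb⟩ := (pow_dvd_pow p h).trans (Nat.ordProj_dvd t p)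
  have hpow : 0 < p ^ t'.factorization p := pow_pos hp.pos _
  refine ⟨a, b, ?_, fun hpa => ?_, ?_⟩
  · linear_combination a * hb - b * ha
  · refine Nat.pow_succ_factorization_not_dvd ht'.ne' hp ?_
    rw [pow_succ]
    exact (mul_dvd_mul_left _ hpa).trans ha.symm.dvd
  · rw [← Nat.mul_dvd_mul_iff_left hpow, ← hb, ← pow_succ, hp.pow_dvd_iff_le_factorization ht.ne',
      Nat.succ_le_iff]

theorem WeaklyTiles.disjoint_cyclotomicPrimePowers {G : Type*} [AddCommGroupWithOne G] [Finite G]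
    {m n m' n' : ℕ} {R : ℤ[X]} (hm : 0 < m) (hn : 0 < n) (hm' : 0 < m') (hn' : 0 < n')
    (h : WeaklyTiles G (progressionPoly m n * (progressionPoly m' n' * R)))
    (hR : R ∈ nonnegCoeff) :
    Disjoint (cyclotomicPrimePowers (progressionPoly m n))
      (cyclotomicPrimePowers (progressionPoly m' n')) := by
  refine Set.disjoint_left.mpr fun s hs hs' => ?_
  obtain ⟨p, k, hp, -, rfl⟩ := (isPrimePow_nat_iff s).mp hs.1
  obtain ⟨t, ht, htk, -, Q, hQ, hfactor⟩ := exists_progressionPoly_factor hm hn hp hs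
  obtain ⟨t', ht', htk', -, Q', hQ', hfactor'⟩ := exists_progressionPoly_factor hm' hn' hp hs'
  obtain ⟨a, b, hab, ha, hb⟩ := exists_mul_eq_mul_of_factorization_le hp ht ht' (by omega)
  have hb : ¬ p ∣ b := fun hpb => by have := hb.mp hpb; omega
  have htile : WeaklyTiles G
      ((∏ i, progressionPoly (![t, t'] i) ((fun _ => p) i)) * (Q * (Q' * R))) := by
    convert h using 1
    rw [hfactor, hfactor', Fin.prod_univ_two, Matrix.cons_val_zero, Matrix.cons_val_one,
      Matrix.cons_val_fin_one]
    ring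
  refine htile.sum_mul_ne_zero (mul_mem hQ (mul_mem hQ' hR)) (fun _ => hp.one_lt)
    (c := ![(a : ℤ), -(b : ℤ)]) (Fin.forall_fin_two.mpr ⟨?_, ?_⟩) ?_
  · exact Nat.isCoprime_iff_coprime.mpr ((hp.coprime_iff_not_dvd.mpr ha).symm)
  · exact (Nat.isCoprime_iff_coprime.mpr ((hp.coprime_iff_not_dvd.mpr hb).symm)).neg_left
  · have hab' : (a : ℤ) * t = b * t' := by exact_mod_cast hab
    simp [hab']

/-- Weight the `i`-th vector by the product of the primes other than `p i`. -/
theorem exists_mem_forall_not_prime_dvd {ι : Type*} [Finite ι] {p : ι → ℕ}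
    (hp : ∀ i, (p i).Prime) (V : Submodule ℤ (ι → ℤ))
    (h : ∀ i, ∃ u ∈ V, ¬ (p i : ℤ) ∣ u i ∧ ∀ l ≠ i, p l = p i → (p l : ℤ) ∣ u l) :
    ∃ c ∈ V, ∀ i, ¬ (p i : ℤ) ∣ c i := by
  classical
  cases nonempty_fintype ι
  choose u huV hu hul using h
  let τ (i : ι) : ℕ := ∏ q ∈ (Finset.univ.image p).erase (p i), q
  refine ⟨∑ i, (τ i : ℤ) • u i, sum_mem fun i _ => V.smul_mem _ (huV i), fun l hl => ?_⟩
  simp only [Finset.sum_apply, Pi.smul_apply, smul_eq_mul] at hl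
  rw [← Finset.add_sum_erase _ _ (Finset.mem_univ l)] at hl
  have hrest : (p l : ℤ) ∣ ∑ i ∈ Finset.univ.erase l, (τ i : ℤ) * u i l := by
    refine Finset.dvd_sum fun i hi => ?_
    by_cases hpli : p l = p i
    · exact (hul i l (Finset.ne_of_mem_erase hi).symm hpli).mul_left _
    · refine Dvd.dvd.mul_right (Int.natCast_dvd_natCast.mpr ?_) _
      exact Finset.dvd_prod_of_mem id
        (Finset.mem_erase.mpr ⟨hpli, Finset.mem_image_of_mem p (Finset.mem_univ l)⟩)
  have hdiag : (p l : ℤ) ∣ τ l := ((Nat.prime_iff_prime_int.mp (hp l)).dvd_or_dvd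
    ((dvd_add_left hrest).mp hl)).resolve_right (hu l)
  rw [Int.natCast_dvd_natCast, (hp l).prime.dvd_finsetProd_iff] at hdiag
  obtain ⟨q, hq, hlq⟩ := hdiag
  obtain ⟨hne, hq⟩ := Finset.mem_erase.mp hq
  obtain ⟨i, -, rfl⟩ := Finset.mem_image.mp hq
  exact hne ((Nat.prime_dvd_prime_iff_eq (hp l) (hp i)).mp hlq).symm

variable {ι : Type*} [Fintype ι]

theorem exists_sum_mul_eq_zero_forall_not_prime_dvd {t p : ι → ℕ} (ht : ∀ i, 0 < t i)
    (hp : ∀ i, (p i).Prime)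
    (h : ∀ i, ∃ j ≠ i, (t j * p j).factorization (p i) ≤ (t i).factorization (p i)) :
    ∃ c : ι → ℤ, ∑ i, c i * t i = 0 ∧ ∀ i, ¬ (p i : ℤ) ∣ c i := by
  classical
  let V : Submodule ℤ (ι → ℤ) := LinearMap.ker (Fintype.linearCombination ℤ fun i => (t i : ℤ))
  refine exists_mem_forall_not_prime_dvd hp V fun i => ?_
  obtain ⟨j, hji, hj⟩ := h i
  rw [Nat.factorization_mul (ht j).ne' (hp j).ne_zero, Finsupp.add_apply] at hj
  obtain ⟨a, b, hab, ha, hb⟩ := exists_mul_eq_mul_of_factorization_le (hp i) (ht i) (ht j)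
    (le_of_add_le_left hj)
  refine ⟨Pi.single i (a : ℤ) - Pi.single j (b : ℤ), ?_, ?_, fun l hli hpli => ?_⟩
  · have hab' : (a : ℤ) * t i = b * t j := by exact_mod_cast hab
    rw [LinearMap.mem_ker, map_sub, Fintype.linearCombination_apply_single,
      Fintype.linearCombination_apply_single, smul_eq_mul, smul_eq_mul, hab', sub_self]
  · rwa [Pi.sub_apply, Pi.single_eq_same, Pi.single_eq_of_ne hji.symm, sub_zero,
      Int.natCast_dvd_natCast]
  · rw [Pi.sub_apply, Pi.single_eq_of_ne hli, zero_sub, dvd_neg]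
    obtain rfl | hlj := eq_or_ne l j
    · rw [hpli, (hp i).factorization_self, Nat.add_one_le_iff, ← hb] at hj
      rw [Pi.single_eq_same, hpli]
      exact Int.natCast_dvd_natCast.mpr hj
    · rw [Pi.single_eq_of_ne hlj]
      exact dvd_zero _

theorem WeaklyTiles.exists_forall_ne_dvd_div_gcd [Nonempty ι] {G : Type*} [AddCommGroupWithOne G]
    [Finite G] {m n : ι → ℕ} (h : WeaklyTiles G (∏ i, progressionPoly (m i) (n i)))
    (hm : ∀ i, 0 < m i) (hn : ∀ i, 0 < n i) : ∃ i, ∀ j ≠ i, n i ∣ m j / (m i).gcd (m j) := by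
  classical
  have hdisj {i j : ι} (hji : j ≠ i) :
      Disjoint (cyclotomicPrimePowers (progressionPoly (m i) (n i)))
        (cyclotomicPrimePowers (progressionPoly (m j) (n j))) := by
    rw [← Finset.mul_prod_erase _ _ (Finset.mem_univ i),
      ← Finset.mul_prod_erase _ _ (Finset.mem_erase.mpr ⟨hji, Finset.mem_univ j⟩)] at h
    exact h.disjoint_cyclotomicPrimePowers (hm i) (hn i) (hm j) (hn j)
      (prod_mem fun _ _ => progressionPoly_mem_nonnegCoeff _ _)
  by_contra! hcon
  have hlayer (i : ι) : ∃ j ≠ i, ∃ p k, p.Prime ∧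
      p ^ k ∈ cyclotomicPrimePowers (progressionPoly (m i) (n i)) ∧ ¬ p ^ k ∣ m j * n j := by
    obtain ⟨j, hji, hj⟩ := hcon i
    rw [dvd_div_gcd_iff_forall_mem_cyclotomicPrimePowers (hm i) (hn i) (hm j)] at hj
    push Not at hj
    obtain ⟨s, hs, hsj⟩ := hj
    obtain ⟨p, k, hp, -, rfl⟩ := (isPrimePow_nat_iff s).mp hs.1
    exact ⟨j, hji, p, k, hp, hs, fun hdvd => Set.disjoint_left.mp (hdisj hji) hs
      ((mem_cyclotomicPrimePowers_progressionPoly (hm j) (hn j)).mpr ⟨hs.1, hdvd, hsj⟩)⟩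
  choose j hji p k hp hmem hnot using hlayer
  choose t ht htk htp R hR hfactor using
    fun i => exists_progressionPoly_factor (hm i) (hn i) (hp i) (hmem i)
  have hmn (i : ι) : m i * n i ≠ 0 := (Nat.mul_pos (hm i) (hn i)).ne'
  obtain ⟨c, hsum, hc⟩ := exists_sum_mul_eq_zero_forall_not_prime_dvd ht hp fun i => by
    have hlt := hnot i
    rw [(hp i).pow_dvd_iff_le_factorization (hmn _), ← htk i, not_le, Nat.lt_succ_iff] at hlt
    have htp0 : t (j i) * p (j i) ≠ 0 := mul_ne_zero (ht _).ne' (hp _).ne_zero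
    exact ⟨j i, hji i, ((Nat.factorization_le_iff_dvd htp0 (hmn _)).mpr (htp _) _).trans hlt⟩
  simp only [hfactor, Finset.prod_mul_distrib] at h
  exact h.sum_mul_ne_zero (prod_mem fun i _ => hR i) (fun i => (hp i).one_lt)
    (fun i => ((Nat.prime_iff_prime_int.mp (hp i)).coprime_iff_not_dvd.mpr (hc i)).symm) hsum

end FirstFactor

theorem exists_list_pairwise_of_forall_exists_first {α : Type*} {r : α → α → Prop}
    (h : ∀ S : Finset α, S.Nonempty → ∃ i ∈ S, ∀ j ∈ S, j ≠ i → r i j) (S : Finset α) :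
    ∃ l : List α, l.Nodup ∧ (∀ x, x ∈ l ↔ x ∈ S) ∧ l.Pairwise r := by
  classical
  induction S using Finset.strongInduction with
  | H S ih =>
    obtain rfl | hS := S.eq_empty_or_nonempty
    · exact ⟨[], by simp⟩
    obtain ⟨i, hi, hr⟩ := h S hS
    obtain ⟨l, hnodup, hmem, hl⟩ := ih _ (Finset.erase_ssubset hi)
    refine ⟨i :: l, List.nodup_cons.mpr ⟨by simp [hmem], hnodup⟩, fun x => ?_,
      List.pairwise_cons.mpr ⟨fun j hj => ?_, hl⟩⟩
    · rw [List.mem_cons, hmem, ← Finset.mem_insert, Finset.insert_erase hi]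
    · obtain ⟨hji, hj⟩ := Finset.mem_erase.mp ((hmem j).mp hj)
      exact hr j hj hji

theorem exists_perm_of_forall_exists_first {N : ℕ} {r : Fin N → Fin N → Prop}
    (h : ∀ S : Finset (Fin N), S.Nonempty → ∃ i ∈ S, ∀ j ∈ S, j ≠ i → r i j) :
    ∃ σ : Equiv.Perm (Fin N), ∀ i j, i < j → r (σ i) (σ j) := by
  obtain ⟨l, hnodup, hmem, hl⟩ := exists_list_pairwise_of_forall_exists_first h Finset.univ
  let e := hnodup.getEquivOfForallMemList l fun x => (hmem x).mpr (Finset.mem_univ x)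
  have hlen : N = l.length := by simpa using (Fintype.card_congr e).symm
  exact ⟨(finCongr hlen).trans e, fun i j hij => List.pairwise_iff_get.mp hl _ _ hij⟩

theorem exists_divisibilityTower_of_weaklyTiles {N : ℕ} {m n : Fin N → ℕ} (hm : ∀ i, 0 < m i)
    (hn : ∀ i, 0 < n i) (h : WeaklyTiles ℤ (progressionProd m n)) :
    ∃ σ : Equiv.Perm (Fin N), DivisibilityTower (m ∘ σ) (n ∘ σ) := by
  obtain ⟨M, hM, htile⟩ := h.exists_zmod (progressionProd_mem_nonnegCoeff m n)
  have : NeZero M := ⟨hM⟩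
  obtain ⟨σ, hσ⟩ := exists_perm_of_forall_exists_first
    (r := fun i j => n i ∣ m j / (m i).gcd (m j)) fun S hS => by
      have : Nonempty S := hS.to_subtype
      rw [progressionProd, ← Finset.prod_mul_prod_compl S, ← Finset.prod_coe_sort] at htile
      have hS := htile.of_mul (prod_mem fun _ _ => progressionPoly_mem_nonnegCoeff _ _)
      obtain ⟨i, hi⟩ := hS.exists_forall_ne_dvd_div_gcd (fun i => hm i) fun i => hn i
      exact ⟨i, i.2, fun j hj hji => hi ⟨j, hj⟩ fun h => hji (congrArg Subtype.val h)⟩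
  exact ⟨σ, divisibilityTower_iff.mpr hσ⟩

theorem theorem4p3 {N : ℕ} (m n : Fin N → ℕ) (hm : ∀ i, 0 < m i) (hn : ∀ i, 0 < n i) :
    List.TFAE [
      ConditionT (progressionProd m n),
      ConditionT1 (progressionProd m n) ∧ ConditionT2 (progressionProd m n),
      ∃ σ : Equiv.Perm (Fin N), DivisibilityTower (m ∘ σ) (n ∘ σ)] := by
  tfae_have 1 → 3 := fun h =>
    exists_divisibilityTower_of_weaklyTiles hm hn (conditionT_iff.mp h).2
  tfae_have 3 → 2 := by
    rintro ⟨σ, hσ⟩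
    rw [← progressionProd_comp_perm m n σ]
    exact ⟨hσ.conditionT1 (fun i => hm _) fun i => hn _,
      hσ.conditionT2 (fun i => hm _) fun i => hn _⟩
  tfae_have 2 → 1 := fun ⟨h1, h2⟩ =>
    conditionT_iff.mpr
      ⟨progressionProd_mem_nonnegCoeff m n, weaklyTiles_of_conditionT1_of_conditionT2 h1 h2⟩
  tfae_finish
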